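/- Let $q$ be a prime power, let $\mathbb{F}_q$ be the field with $q$ elements and $\overline{\mathbb{F}}_q$ its algebraic closure. Call $\alpha \in GL(n,q)$ regular if, among all elements of the algebraic group $GL(n,\overline{\mathbb{F}}_q)$, the dimension of the centralizer of $\alpha$ in $GL(n,\overline{\mathbb{F}}_q)$ is as small as possible. Then $$\lim_{n\to\infty} \frac{|\{\alpha \in GL(n,q) : \alpha \text{ is regular}\}|}{|GL(n,q)|} = \frac{1-\frac{1}{q^5}}{1+\frac{1}{q^3}}.$$ -/

import Mathlib

/-- The Zariski dimension of a set `S` of `n × n` matrices over a field `K`: the Krull dimension of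
the coordinate ring `K[x_ij] / I(S)` of the Zariski closure of `S` in the affine space of all
`n × n` matrices. For a subset of `GL(n, K)` that is Zariski closed in `GL(n, K)`, hence locally
closed in the affine space, this is its dimension as a variety when `K` is algebraically closed. -/
noncomputable def zariskiDim {K : Type*} [Field K] {n : ℕ}
    (S : Set (Matrix (Fin n) (Fin n) K)) : WithBot ℕ∞ :=
  ringKrullDim (MvPolynomial (Fin n × Fin n) K ⧸
    MvPolynomial.vanishingIdeal K
      ((fun (A : Matrix (Fin n) (Fin n) K) (p : Fin n × Fin n) => A p.1 p.2) '' S))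

/-- The dimension of the centralizer of `g` in the algebraic group `GL(n, K)`. -/
noncomputable def centralizerDim {K : Type*} [Field K] {n : ℕ}
    (g : Matrix.GeneralLinearGroup (Fin n) K) : WithBot ℕ∞ :=
  zariskiDim ((fun h : Matrix.GeneralLinearGroup (Fin n) K => (h : Matrix (Fin n) (Fin n) K)) ''
    (Subgroup.centralizer {g} : Set (Matrix.GeneralLinearGroup (Fin n) K)))

/-- An element of the algebraic group `GL(n, K)` (`K` algebraically closed) is regular if the
dimension of its centralizer is as small as possible. -/
def IsRegularElement {K : Type*} [Field K] {n : ℕ}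
    (g : Matrix.GeneralLinearGroup (Fin n) K) : Prop :=
  ∀ h : Matrix.GeneralLinearGroup (Fin n) K, centralizerDim g ≤ centralizerDim h

/-- An element of `GL(n, F)` is regular if it is regular as an element of the algebraic group
`GL(n, F̄)`, where `F̄` is the algebraic closure of `F`. -/
def IsRegularGL {F : Type*} [Field F] {n : ℕ}
    (α : Matrix.GeneralLinearGroup (Fin n) F) : Prop :=
  IsRegularElement (Matrix.GeneralLinearGroup.map (algebraMap F (AlgebraicClosure F)) α)

/-- The probability that a uniformly distributed element of the finite group `GL(n, F)` is
regular. -/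
noncomputable def probRegularGL (F : Type*) [Field F] [Fintype F] (n : ℕ) : ℝ :=
  (Nat.card {α : Matrix.GeneralLinearGroup (Fin n) F // IsRegularGL α} : ℝ) /
    (Nat.card (Matrix.GeneralLinearGroup (Fin n) F) : ℝ)

/-!
The proof turns the geometric condition into linear algebra, counts, and sums over polynomials.

*Regular means cyclic.* The centralizer of `g` in `GL(n, K)` is the set of invertible elements of
the commutant of `g`, a linear subspace, so for infinite `K` its dimension is the linear dimension
of the commutant (`centralizerDim_eq_finrank`). That dimension is `n` if `g` is cyclic, i.e. has a
vector `v` with `v, g v, ..., g ^ (n - 1) v` a basis, and larger otherwise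
(`lt_finrank_commutant_of_not_isCyclicMatrix`, from the structure theorem for modules over `K[X]`).
Cyclicity passes between `F` and its algebraic closure, whence `isRegularGL_iff_isCyclicMatrix`.

*Counting.* The cyclic elements of `GL(n, F)` with a given characteristic polynomial `f` form one
conjugacy class, with centralizer the unit group of `F[X] / (f)`. Hence the probability is the sum
of `1 / |(F[X] / (f))ˣ|` over the monic `f` of degree `n` with `f(0) ≠ 0`
(`probRegularGL_eq_sum`).

*Summing.* Let `q = |F|` and `|f| = q ^ deg f`, and let all polynomials below be monic and prime to
`X`. Since `|f| / |(F[X] / (f))ˣ|` is the product of `(1 - 1 / |p|)⁻¹` over the primes `p` dividing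
`f`, it is the sum of `1 / |h|` over the `h` whose primes all divide `f`. Exchanging the sums, `h`
is weighted with `1 / |h|` times `q ^ (-n)` times the number of `f` of degree `n` divisible by the
radical of `h`; that number is eventually `(1 - 1 / q) q ^ n / |rad h|`, and dominated convergence
gives the limit `(1 - 1 / q) ∑ 1 / |h * rad h|`. Here `h * rad h` runs over the squarefull
polynomials, and comparing exponents prime by prime yields
`(∑ 1 / |h * rad h|) * ζ(6) = ζ(2) * ζ(3)` (`exists_equiv_weight_radical`), where
`ζ(s) = ∑ |f| ^ (-s) = (1 - q ^ (-s)) / (1 - q ^ (1 - s))` (`hasSum_pow_weight`).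

Polynomials are encoded by their exponent vectors `MonicPrime F →₀ ℕ`, the degree being
`Finsupp.weight`.
-/

/-! ### Dimension of the centralizer -/

section

open Module

/-- The invertible elements of a linear subspace containing `1` are dense in it: its coordinate ring
is a polynomial ring, in which the determinant is not a zero divisor. -/
lemma zariskiDim_invertible_submodule {K : Type*} [Field K] [Infinite K] {n : ℕ}
    (W : Submodule K (Matrix (Fin n) (Fin n) K)) (h1 : 1 ∈ W) :
    zariskiDim ((fun h : Matrix.GeneralLinearGroup (Fin n) K => (h : Matrix (Fin n) (Fin n) K)) ''
      {g | (g : Matrix (Fin n) (Fin n) K) ∈ W}) = (finrank K W : WithBot ℕ∞) := by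
  classical
  let b := Module.finBasis K W
  -- Restriction of polynomial functions to `W`, in coordinates with respect to `b`.
  let φ : MvPolynomial (Fin n × Fin n) K →ₐ[K] MvPolynomial (Fin (finrank K W)) K :=
    MvPolynomial.aeval fun p =>
      ∑ k, MvPolynomial.C ((b k : Matrix _ _ K) p.1 p.2) * MvPolynomial.X k
  have hφX (p) : φ (MvPolynomial.X p) =
      ∑ k, MvPolynomial.C ((b k : Matrix _ _ K) p.1 p.2) * MvPolynomial.X k :=
    MvPolynomial.aeval_X _ _
  have heval (x : Fin (finrank K W) → K) (f) : MvPolynomial.eval x (φ f) =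
      MvPolynomial.aeval (fun p : Fin n × Fin n =>
        ((∑ k, x k • b k : W) : Matrix _ _ K) p.1 p.2) f := by
    have : (MvPolynomial.aeval x).comp φ = MvPolynomial.aeval (fun p : Fin n × Fin n =>
        ((∑ k, x k • b k : W) : Matrix _ _ K) p.1 p.2) := by
      ext p
      simp [hφX, Matrix.sum_apply, mul_comm]
    rw [← this]
    simp [MvPolynomial.aeval_eq_eval]
  have hsurj : Function.Surjective φ := by
    rw [← AlgHom.range_eq_top, ← top_le_iff, ← MvPolynomial.adjoin_range_X, Algebra.adjoin_le_iff]
    rintro _ ⟨k, rfl⟩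
    -- The `k`-th coordinate on `W` extends to a linear form `l` on all matrices.
    obtain ⟨l, hl⟩ := LinearMap.exists_extend (b.coord k)
    refine ⟨∑ p : Fin n × Fin n, MvPolynomial.C (l (Matrix.single p.1 p.2 1)) * MvPolynomial.X p, ?_⟩
    have hlb (j : Fin (finrank K W)) :
        ∑ p : Fin n × Fin n, l (Matrix.single p.1 p.2 1) * (b j : Matrix _ _ K) p.1 p.2 =
        if j = k then 1 else 0 := by
      have h2 : l (b j : Matrix _ _ K) = if j = k then 1 else 0 := by
        have := LinearMap.congr_fun hl (b j)
        simp only [LinearMap.comp_apply, Submodule.subtype_apply] at this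
        rw [this]; simp [Finsupp.single_apply]
      rw [← h2]
      conv_rhs => rw [Matrix.matrix_eq_sum_single (b j : Matrix (Fin n) (Fin n) K)]
      rw [Fintype.sum_prod_type, map_sum]
      refine Finset.sum_congr rfl fun i _ => ?_
      rw [map_sum]
      refine Finset.sum_congr rfl fun i' _ => ?_
      have : Matrix.single i i' ((b j : Matrix _ _ K) i i') =
        ((b j : Matrix _ _ K) i i') • Matrix.single i i' (1 : K) := by simp
      rw [this, map_smul, smul_eq_mul, mul_comm]
    change φ _ = _
    simp only [map_sum, map_mul, hφX, Finset.mul_sum]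
    rw [Finset.sum_comm]
    have hcol (j : Fin (finrank K W)) : ∑ p : Fin n × Fin n,
        φ (MvPolynomial.C (l (Matrix.single p.1 p.2 1))) *
        (MvPolynomial.C ((b j : Matrix _ _ K) p.1 p.2) * MvPolynomial.X j)
        = MvPolynomial.C (if j = k then 1 else 0) * MvPolynomial.X j := by
      rw [← hlb, map_sum, Finset.sum_mul]
      refine Finset.sum_congr rfl fun p _ => ?_
      rw [← MvPolynomial.algebraMap_eq, AlgHom.commutes, MvPolynomial.algebraMap_eq, map_mul,
        mul_assoc]
    rw [Finset.sum_congr rfl fun j _ => hcol j]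
    simp
  have hker : RingHom.ker φ = MvPolynomial.vanishingIdeal K
      ((fun (A : Matrix (Fin n) (Fin n) K) (p : Fin n × Fin n) => A p.1 p.2) ''
      ((fun h : Matrix.GeneralLinearGroup (Fin n) K => (h : Matrix (Fin n) (Fin n) K)) ''
      {g | (g : Matrix (Fin n) (Fin n) K) ∈ W})) := by
    ext f
    rw [MvPolynomial.mem_vanishingIdeal_iff, RingHom.mem_ker]
    constructor
    · rintro hf _ ⟨_, ⟨g, hg, rfl⟩, rfl⟩
      have := heval (b.repr ⟨g, hg⟩) f
      rw [hf, b.sum_repr] at this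
      simpa using this.symm
    · intro hf
      -- `f` times the determinant vanishes on all of `W`, and the determinant is not zero on `W`.
      let D : MvPolynomial (Fin n × Fin n) K := (Matrix.mvPolynomialX (Fin n) (Fin n) K).det
      have hD (M : Matrix (Fin n) (Fin n) K) :
          MvPolynomial.aeval (fun p : Fin n × Fin n => M p.1 p.2) D = M.det := by
        rw [AlgHom.map_det]
        congr 1
        ext i j
        simp [Matrix.mvPolynomialX]
      have hprod : φ f * φ D = 0 := by
        refine MvPolynomial.funext fun x => ?_
        rw [map_mul, heval, heval, hD, map_zero]
        by_cases hx : ((∑ k, x k • b k : W) : Matrix (Fin n) (Fin n) K).det = 0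
        · rw [hx, mul_zero]
        · have hfx := hf _ ⟨_, ⟨Matrix.GeneralLinearGroup.mkOfDetNeZero _ hx,
            (∑ k, x k • b k : W).2, rfl⟩, rfl⟩
          exact mul_eq_zero_of_left hfx _
      refine (mul_eq_zero.1 hprod).resolve_right fun h0 => ?_
      have := heval (b.repr ⟨1, h1⟩) D
      rw [h0, b.sum_repr, hD] at this
      simp at this
  unfold zariskiDim
  rw [← hker, ringKrullDim_eq_of_ringEquiv
    (Ideal.quotientKerAlgEquivOfSurjective hsurj).toRingEquiv,
    MvPolynomial.ringKrullDim_of_isNoetherianRing, ringKrullDim_eq_zero_of_field]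
  simp

/-- The dimension of the centralizer of `g` in the algebraic group is the linear dimension of the
algebra of matrices commuting with `g`, in which the centralizer is open. -/
lemma centralizerDim_eq_finrank {K : Type*} [Field K] [Infinite K] {n : ℕ}
    (g : Matrix.GeneralLinearGroup (Fin n) K) :
    centralizerDim g =
      (finrank K (Subalgebra.centralizer K {(g : Matrix (Fin n) (Fin n) K)}) : WithBot ℕ∞) := by
  refine Eq.trans ?_ (zariskiDim_invertible_submodule
    (Subalgebra.toSubmodule (Subalgebra.centralizer K {(g : Matrix (Fin n) (Fin n) K)}))
    (one_mem (Subalgebra.centralizer K {(g : Matrix (Fin n) (Fin n) K)})))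
  unfold centralizerDim
  congr 2
  ext h
  simp [Subgroup.mem_centralizer_iff, Subalgebra.mem_centralizer_iff, Units.ext_iff]
  exact ⟨fun H => H g rfl, fun H k hk => by rw [hk]; exact H⟩

end

/-! ### Cyclic matrices -/

section

open Module Polynomial

variable {K : Type*} [Field K] {n : ℕ}

/-- The Krylov matrix of `A` and `v`, with columns `v, A v, …, A ^ (n - 1) v`. -/
def krylov (A : Matrix (Fin n) (Fin n) K) (v : Fin n → K) : Matrix (Fin n) (Fin n) K :=
  Matrix.of fun i j => (A ^ (j : ℕ)).mulVec v i

/-- A matrix is cyclic if `v, A v, …, A ^ (n - 1) v` is a basis for some vector `v`. -/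
def IsCyclicMatrix (A : Matrix (Fin n) (Fin n) K) : Prop :=
  ∃ v, IsUnit (krylov A v)

lemma mul_krylov_col (T A : Matrix (Fin n) (Fin n) K) (v : Fin n → K) (j : Fin n) :
    (T * krylov A v).col j = T.mulVec ((A ^ (j : ℕ)).mulVec v) := by
  ext i
  simp [Matrix.mul_apply, krylov, Matrix.mulVec, dotProduct]

/-- The Krylov matrix represents evaluation at `A` and `v` of polynomials of degree less than `n`. -/
lemma krylov_mulVec_coeff (A : Matrix (Fin n) (Fin n) K) (v : Fin n → K) {p : K[X]}
    (hp : p.degree < n) :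
    (krylov A v).mulVec (fun j => p.coeff j) = (aeval A p).mulVec v := by
  ext i
  have hn : 0 < n := i.pos
  have hd : p.natDegree < n := by
    rcases eq_or_ne p 0 with rfl | h0
    · simpa using hn
    · exact (natDegree_lt_iff_degree_lt h0).2 hp
  rw [aeval_eq_sum_range' hd, Finset.sum_range, Matrix.sum_mulVec, Finset.sum_apply]
  simp [Matrix.mulVec, dotProduct, krylov, Finset.mul_sum, mul_assoc, mul_comm]

lemma exists_aeval_mulVec_eq {A : Matrix (Fin n) (Fin n) K} {v : Fin n → K}
    (hv : IsUnit (krylov A v)) (u : Fin n → K) :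
    ∃ p : K[X], p.degree < n ∧ (aeval A p).mulVec v = u := by
  let c := (krylov A v)⁻¹.mulVec u
  have hc : (∑ j : Fin n, monomial j (c j) : K[X]).degree < n :=
    degree_sum_fin_lt c |> fun h => by simpa [C_mul_X_pow_eq_monomial] using h
  refine ⟨_, hc, ?_⟩
  rw [← krylov_mulVec_coeff A v hc]
  have : (fun j : Fin n => (∑ j : Fin n, monomial j (c j) : K[X]).coeff j) = c := by
    ext j
    simp [coeff_monomial, Fin.val_inj]
  rw [this, Matrix.mulVec_mulVec, Matrix.mul_nonsing_inv _ ((Matrix.isUnit_iff_isUnit_det _).1 hv),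
    Matrix.one_mulVec]

lemma eq_zero_of_aeval_mulVec {A : Matrix (Fin n) (Fin n) K} {v : Fin n → K}
    (hv : IsUnit (krylov A v)) {p : K[X]} (hp : p.degree < n) (h : (aeval A p).mulVec v = 0) :
    p = 0 := by
  rw [← krylov_mulVec_coeff A v hp] at h
  have h0 := Matrix.mulVec_injective_of_isUnit hv (h.trans (Matrix.mulVec_zero _).symm)
  ext j
  by_cases hj : j < n
  · simpa using congrFun h0 ⟨j, hj⟩
  · rw [coeff_zero]
    exact coeff_eq_zero_of_degree_lt (hp.trans_le (by exact_mod_cast not_lt.1 hj))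

lemma degree_modByMonic_charpoly_lt (A : Matrix (Fin n) (Fin n) K) (p : K[X]) :
    (p %ₘ A.charpoly).degree < n := by
  have := degree_modByMonic_lt p A.charpoly_monic
  rwa [A.charpoly_degree_eq_dim, Fintype.card_fin] at this

lemma aeval_modByMonic_charpoly (A : Matrix (Fin n) (Fin n) K) (p : K[X]) :
    aeval A (p %ₘ A.charpoly) = aeval A p :=
  aeval_modByMonic_eq_self_of_root A.aeval_self_charpoly

lemma ker_aeval_of_isCyclicMatrix {A : Matrix (Fin n) (Fin n) K} (hA : IsCyclicMatrix A) :
    RingHom.ker (aeval A : K[X] →ₐ[K] _) = Ideal.span {A.charpoly} := by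
  obtain ⟨v, hv⟩ := hA
  ext p
  rw [RingHom.mem_ker, Ideal.mem_span_singleton, ← modByMonic_eq_zero_iff_dvd A.charpoly_monic]
  constructor
  · intro h
    refine eq_zero_of_aeval_mulVec hv (degree_modByMonic_charpoly_lt A p) ?_
    rw [aeval_modByMonic_charpoly, h, Matrix.zero_mulVec]
  · intro h
    rw [← aeval_modByMonic_charpoly, h, map_zero]

lemma range_aeval_of_isCyclicMatrix {A : Matrix (Fin n) (Fin n) K} (hA : IsCyclicMatrix A) :
    (aeval A : K[X] →ₐ[K] _).range = Subalgebra.centralizer K {A} := by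
  obtain ⟨v, hv⟩ := hA
  apply le_antisymm
  · rintro _ ⟨p, rfl⟩
    simp only [Subalgebra.mem_centralizer_iff, Set.mem_singleton_iff, forall_eq]
    exact (commute_X p).map (aeval A) |> fun h => by simpa using h.eq
  · intro T hT
    simp only [Subalgebra.mem_centralizer_iff, Set.mem_singleton_iff, forall_eq] at hT
    obtain ⟨p, -, hp⟩ := exists_aeval_mulVec_eq hv (T.mulVec v)
    refine ⟨p, ?_⟩
    change aeval A p = T
    rw [← hv.mul_left_inj]
    refine Matrix.ext_col fun j => ?_
    have h1 : Commute T (A ^ (j : ℕ)) := Commute.pow_right hT.symm _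
    have h2 : Commute (aeval A p) (A ^ (j : ℕ)) := by
      simpa using ((commute_X_pow p j).symm.map (aeval A))
    rw [mul_krylov_col, mul_krylov_col, Matrix.mulVec_mulVec, Matrix.mulVec_mulVec, h1.eq, h2.eq,
      ← Matrix.mulVec_mulVec, hp, Matrix.mulVec_mulVec]

/-- The commutant of a cyclic matrix consists of the polynomials in it. -/
noncomputable def commutantEquivOfIsCyclicMatrix {A : Matrix (Fin n) (Fin n) K}
    (hA : IsCyclicMatrix A) :
    (K[X] ⧸ Ideal.span {A.charpoly}) ≃ₐ[K] Subalgebra.centralizer K {A} :=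
  (Ideal.quotientEquivAlgOfEq K (ker_aeval_of_isCyclicMatrix hA).symm).trans
    ((Ideal.quotientKerEquivRange (aeval A : K[X] →ₐ[K] _)).trans
      (Subalgebra.equivOfEq _ _ (range_aeval_of_isCyclicMatrix hA)))

lemma finrank_commutant_of_isCyclicMatrix {A : Matrix (Fin n) (Fin n) K} (hA : IsCyclicMatrix A) :
    finrank K (Subalgebra.centralizer K {A}) = n := by
  rw [← (commutantEquivOfIsCyclicMatrix hA).toLinearEquiv.finrank_eq,
    finrank_quotient_span_eq_natDegree, A.charpoly_natDegree_eq_dim, Fintype.card_fin]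

/-- The change of Krylov bases carries `p(A) v` to `p(B) w`, as both depend only on `p` modulo the
common characteristic polynomial. -/
lemma krylov_mul_inv_mulVec {A B : Matrix (Fin n) (Fin n) K} {v w : Fin n → K}
    (hv : IsUnit (krylov A v)) (hAB : A.charpoly = B.charpoly) (p : K[X]) :
    (krylov B w * (krylov A v)⁻¹).mulVec ((aeval A p).mulVec v) = (aeval B p).mulVec w := by
  rw [← aeval_modByMonic_charpoly A, ← aeval_modByMonic_charpoly B, ← hAB,
    ← krylov_mulVec_coeff A v (degree_modByMonic_charpoly_lt A p),
    ← krylov_mulVec_coeff B w (degree_modByMonic_charpoly_lt A p), Matrix.mulVec_mulVec,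
    mul_assoc, Matrix.nonsing_inv_mul _ ((Matrix.isUnit_iff_isUnit_det _).1 hv), mul_one]

/-- Cyclic matrices with the same characteristic polynomial are conjugate. -/
lemma exists_conj_of_charpoly_eq {A B : Matrix (Fin n) (Fin n) K} (hA : IsCyclicMatrix A)
    (hB : IsCyclicMatrix B) (hAB : A.charpoly = B.charpoly) :
    ∃ P : Matrix.GeneralLinearGroup (Fin n) K, (P : Matrix (Fin n) (Fin n) K) * A = B * P := by
  obtain ⟨v, hv⟩ := hA
  obtain ⟨w, hw⟩ := hB
  have hP : IsUnit (krylov B w * (krylov A v)⁻¹) := hw.mul ((Matrix.isUnit_nonsing_inv_iff).2 hv)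
  refine ⟨hP.unit, ?_⟩
  rw [IsUnit.unit_spec]
  refine Matrix.ext_of_mulVec_single fun i => ?_
  obtain ⟨p, -, hp⟩ := exists_aeval_mulVec_eq hv (Pi.single i 1)
  have hX (M : Matrix (Fin n) (Fin n) K) (u : Fin n → K) :
      M.mulVec ((aeval M p).mulVec u) = (aeval M (X * p)).mulVec u := by
    rw [Matrix.mulVec_mulVec, map_mul, aeval_X]
  rw [← hp, ← Matrix.mulVec_mulVec, ← Matrix.mulVec_mulVec _ B, hX, krylov_mul_inv_mulVec hv hAB,
    krylov_mul_inv_mulVec hv hAB, hX]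

lemma IsCyclicMatrix.conj {A B : Matrix (Fin n) (Fin n) K} (hA : IsCyclicMatrix A)
    (P : Matrix.GeneralLinearGroup (Fin n) K) (h : (P : Matrix (Fin n) (Fin n) K) * A = B * P) :
    IsCyclicMatrix B := by
  obtain ⟨v, hv⟩ := hA
  refine ⟨(P : Matrix (Fin n) (Fin n) K).mulVec v, ?_⟩
  have : krylov B ((P : Matrix (Fin n) (Fin n) K).mulVec v) = P * krylov A v := by
    refine Matrix.ext_col fun j => ?_
    rw [mul_krylov_col, Matrix.mulVec_mulVec]
    have hj : (P : Matrix (Fin n) (Fin n) K) * A ^ (j : ℕ) = B ^ (j : ℕ) * P :=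
      SemiconjBy.pow_right h j
    rw [hj, ← Matrix.mulVec_mulVec]
    rfl
  rw [this]
  exact P.isUnit.mul hv

/-- Every monic polynomial is the characteristic polynomial of a cyclic matrix. -/
lemma exists_isCyclicMatrix_charpoly {f : K[X]} (hf : f.Monic) (hn : f.natDegree = n) :
    ∃ A : Matrix (Fin n) (Fin n) K, IsCyclicMatrix A ∧ A.charpoly = f := by
  subst hn
  -- Multiplication by the root on `K[X] / (f)`, with cyclic vector `1`.
  let pb := AdjoinRoot.powerBasis hf.ne_zero
  let b : Basis (Fin f.natDegree) K (AdjoinRoot f) := pb.basis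
  let A := Algebra.leftMulMatrix b (AdjoinRoot.root f)
  refine ⟨A, ⟨b.repr 1, ?_⟩, ?_⟩
  · have : krylov A (b.repr 1) = 1 := by
      ext i j
      have h1 : A ^ (j : ℕ) = Algebra.leftMulMatrix b (AdjoinRoot.root f ^ (j : ℕ)) :=
        (map_pow _ _ _).symm
      have h2 : AdjoinRoot.root f ^ (j : ℕ) = b j := (pb.basis_eq_pow j).symm
      rw [krylov, Matrix.of_apply, h1, Algebra.leftMulMatrix_mulVec_repr, mul_one, h2]
      simp [Matrix.one_apply, Finsupp.single_apply, eq_comm]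
    rw [this]
    exact isUnit_one
  · have := charpoly_leftMulMatrix pb
    rw [AdjoinRoot.powerBasis_gen, AdjoinRoot.minpoly_root hf.ne_zero, hf.leadingCoeff, inv_one,
      C_1, mul_one] at this
    exact this

/-- There are invertible cyclic matrices of every size. -/
lemma exists_isCyclicMatrix_unit (K : Type*) [Field K] (n : ℕ) :
    ∃ g : Matrix.GeneralLinearGroup (Fin n) K, IsCyclicMatrix (g : Matrix (Fin n) (Fin n) K) := by
  obtain ⟨A, hA, hc⟩ := exists_isCyclicMatrix_charpoly (K := K) (n := n)
    ((monic_X_sub_C (1 : K)).pow n) (by rw [natDegree_pow, natDegree_X_sub_C, mul_one])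
  refine ⟨Matrix.GeneralLinearGroup.mkOfDetNeZero A ?_, hA⟩
  rw [Matrix.det_eq_sign_charpoly_coeff, hc]
  simp [coeff_zero_eq_eval_zero]

lemma isCyclicMatrix_map {L : Type*} [Field L] (φ : K →+* L) {A : Matrix (Fin n) (Fin n) K}
    (hA : IsCyclicMatrix A) : IsCyclicMatrix (A.map φ) := by
  obtain ⟨v, hv⟩ := hA
  refine ⟨φ ∘ v, ?_⟩
  have : krylov (A.map φ) (φ ∘ v) = φ.mapMatrix (krylov A v) := by
    ext i j
    have := RingHom.map_pow φ.mapMatrix A (j : ℕ)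
    simp only [RingHom.mapMatrix_apply] at this
    simp [krylov, ← this, RingHom.map_mulVec]
  rw [this]
  exact hv.map _

end

/-! ### Endomorphisms of torsion modules over `K[X]` -/

section

open Module Polynomial

variable {K : Type*} [Field K]

/-- A product of algebras with a non-zero linear map between two different factors has more
endomorphisms than elements: multiplications are independent of that off-diagonal map. -/
lemma finrank_pi_lt_finrank_end {R ι : Type*} [CommRing R] [Algebra K R] [Fintype ι]
    (S : ι → Type*) [∀ i, CommRing (S i)] [∀ i, Algebra R (S i)] [∀ i, Algebra K (S i)]
    [∀ i, IsScalarTower K R (S i)] [∀ i, Module.Finite K (S i)] {i j : ι} (hij : i ≠ j)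
    (T : S i →ₗ[R] S j) (hT : T 1 ≠ 0) :
    finrank K (∀ i, S i) < finrank K ((∀ i, S i) →ₗ[R] (∀ i, S i)) := by
  classical
  let N : (∀ i, S i) →ₗ[R] (∀ i, S i) := LinearMap.single R S j ∘ₗ T ∘ₗ LinearMap.proj i
  -- Multiplications, together with one off-diagonal map.
  let Ψ : ((∀ i, S i) × K) →ₗ[K] ((∀ i, S i) →ₗ[R] (∀ i, S i)) :=
    { toFun := fun x => LinearMap.mulLeft R x.1 + x.2 • N
      map_add' := fun x x' => LinearMap.ext fun z => by
        change (x.1 + x'.1) * z + (x.2 + x'.2) • N z =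
          x.1 * z + x.2 • N z + (x'.1 * z + x'.2 • N z)
        rw [add_mul, add_smul, add_add_add_comm]
      map_smul' := fun c x => LinearMap.ext fun z => by
        change (c • x.1) * z + (c * x.2) • N z = c • (x.1 * z + x.2 • N z)
        rw [smul_add, mul_smul, smul_mul_assoc] }
  have hΨ : Function.Injective Ψ := by
    refine (injective_iff_map_eq_zero Ψ).2 ?_
    rintro ⟨s, c⟩ h
    have h1 := LinearMap.congr_fun h 1
    have h2 := congrFun (LinearMap.congr_fun h (Pi.single i 1)) j
    have hN (z : ∀ i, S i) (hz : z i = 1) : N z = Pi.single j (T 1) := by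
      change Pi.single j (T (z i)) = _
      rw [hz]
    have hc0 : c = 0 := by
      change (s * Pi.single i 1 : ∀ i, S i) j + c • (N (Pi.single i 1)) j = 0 at h2
      rw [hN _ (by simp), Pi.mul_apply, Pi.single_eq_of_ne hij.symm, mul_zero, zero_add,
        Pi.single_eq_same] at h2
      exact (smul_eq_zero.1 h2).resolve_right hT
    change s * 1 + c • N 1 = 0 at h1
    rw [hc0, zero_smul, add_zero, mul_one] at h1
    rw [h1, hc0]; rfl
  have : Module.Finite K ((∀ i, S i) →ₗ[R] (∀ i, S i)) :=
    Module.Finite.of_injective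
      (LinearMap.restrictScalarsₗ K R (∀ i, S i) (∀ i, S i) K)
      (LinearMap.restrictScalars_injective K)
  have := LinearMap.finrank_le_finrank_of_injective hΨ
  rw [finrank_prod, finrank_self] at this
  exact this

/-- If two primary components involve the same prime, there is a non-zero map between them. -/
lemma finrank_lt_finrank_end_of_not_isCoprime {ι : Type*} [Fintype ι] (p : ι → K[X])
    (hp : ∀ i, Irreducible (p i)) (e : ι → ℕ) {i j : ι} (hij : i ≠ j)
    (hc : ¬ IsCoprime (p i ^ e i) (p j ^ e j)) :
    finrank K (∀ i, K[X] ⧸ Ideal.span {p i ^ e i}) <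
      finrank K ((∀ i, K[X] ⧸ Ideal.span {p i ^ e i}) →ₗ[K[X]]
        (∀ i, K[X] ⧸ Ideal.span {p i ^ e i})) := by
  have hfin (i) : Module.Finite K (K[X] ⧸ Ideal.span {p i ^ e i}) :=
    (AdjoinRoot.powerBasis (pow_ne_zero _ (hp i).ne_zero)).finite
  have hei : e i ≠ 0 := fun h => hc (by rw [h, pow_zero]; exact isCoprime_one_left)
  have hej : e j ≠ 0 := fun h => hc (by rw [h, pow_zero]; exact isCoprime_one_right)
  have hdvd : p j ∣ p i := by
    by_contra h
    exact hc (((hp j).coprime_iff_not_dvd.2 h).symm.pow)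
  -- The map sending `1` to `p j ^ (e j - 1)`.
  let y : K[X] ⧸ Ideal.span {p j ^ e j} := Ideal.Quotient.mk _ (p j ^ (e j - 1))
  have hy : y ≠ 0 := by
    rw [Ne, Ideal.Quotient.eq_zero_iff_mem, Ideal.mem_span_singleton,
      pow_dvd_pow_iff (hp j).ne_zero (hp j).not_isUnit]
    omega
  let T : (K[X] ⧸ Ideal.span {p i ^ e i}) →ₗ[K[X]] (K[X] ⧸ Ideal.span {p j ^ e j}) :=
    Submodule.liftQ _ (LinearMap.toSpanSingleton K[X] _ y) <| by
      rw [Ideal.span, Submodule.span_le, Set.singleton_subset_iff]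
      change p i ^ e i • y = 0
      have : p i ^ e i • y = Ideal.Quotient.mk _ (p i ^ e i * p j ^ (e j - 1)) := rfl
      rw [this, Ideal.Quotient.eq_zero_iff_mem, Ideal.mem_span_singleton]
      calc p j ^ e j = p j * p j ^ (e j - 1) := by rw [← pow_succ']; congr 1; omega
        _ ∣ _ := mul_dvd_mul_right (hdvd.trans (dvd_pow_self _ hei)) _
  have hT : T 1 = y := by
    change LinearMap.toSpanSingleton K[X] _ y 1 = y
    simp
  exact finrank_pi_lt_finrank_end (fun i => K[X] ⧸ Ideal.span {p i ^ e i}) hij T (hT ▸ hy)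

/-- A finite-dimensional `K[X]`-module is cyclic or has more endomorphisms, by dimension,
than elements. -/
lemma exists_span_singleton_or_finrank_lt {V : Type*} [AddCommGroup V] [Module K V] [Module K[X] V]
    [IsScalarTower K K[X] V] [Module.Finite K[X] V] (hV : Module.IsTorsion K[X] V) :
    (∃ v : V, Submodule.span K[X] {v} = ⊤) ∨ finrank K V < finrank K (V →ₗ[K[X]] V) := by
  classical
  obtain ⟨ι, _, p, hp, e, ⟨E⟩⟩ := Module.equiv_directSum_of_isTorsion hV
  let E' : V ≃ₗ[K[X]] (∀ i, K[X] ⧸ Ideal.span {p i ^ e i}) :=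
    E.trans (DirectSum.linearEquivFunOnFintype K[X] ι _)
  by_cases h : Pairwise (Function.onFun IsCoprime fun i => Ideal.span {p i ^ e i})
  · refine Or.inl ⟨E'.symm 1, ?_⟩
    rw [Submodule.eq_top_iff']
    intro v
    rw [Submodule.mem_span_singleton]
    obtain ⟨r, hr⟩ := Ideal.pi_quotient_surjective h (E' v)
    refine ⟨r, E'.injective ?_⟩
    rw [map_smul, E'.apply_symm_apply]
    ext i
    rw [← hr i]
    change Ideal.Quotient.mk _ (r * 1) = _
    rw [mul_one]
  · right
    simp only [Pairwise, Function.onFun, not_forall, Ideal.isCoprime_span_singleton_iff] at h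
    obtain ⟨i, j, hij, hc⟩ := h
    rw [(E'.restrictScalars K).finrank_eq,
      (LinearEquiv.restrictScalars K (LinearEquiv.conj E' : _ ≃ₗ[K[X]] _)).finrank_eq]
    exact finrank_lt_finrank_end_of_not_isCoprime p hp e hij hc

end

/-! ### Regular elements are the cyclic matrices -/

section

open Module Polynomial

variable {K : Type*} [Field K] {n : ℕ}

lemma toLin'_aeval (A : Matrix (Fin n) (Fin n) K) (p : K[X]) :
    Matrix.toLin' (aeval A p) = aeval (Matrix.toLin' A) p :=
  (aeval_algHom_apply (Matrix.toLinAlgEquiv' : Matrix (Fin n) (Fin n) K ≃ₐ[K] _) A p).symm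

/-- The commutant of `A` is the endomorphism algebra of the `K[X]`-module defined by `A`. -/
lemma lt_finrank_commutant_of_not_isCyclicMatrix {A : Matrix (Fin n) (Fin n) K}
    (hA : ¬ IsCyclicMatrix A) : n < finrank K (Subalgebra.centralizer K {A}) := by
  let φ := Matrix.toLin' A
  rcases exists_span_singleton_or_finrank_lt (V := AEval' φ)
    (Module.AEval.isTorsion_of_finiteDimensional K (Fin n → K) φ) with ⟨v, hv⟩ | h
  · refine absurd ⟨(AEval'.of φ).symm v, ?_⟩ hA
    rw [← Matrix.mulVec_surjective_iff_isUnit]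
    intro w
    obtain ⟨p, hp⟩ := Submodule.mem_span_singleton.1
      (hv ▸ Submodule.mem_top : AEval'.of φ w ∈ Submodule.span K[X] {v})
    refine ⟨fun j => (p %ₘ A.charpoly).coeff j, ?_⟩
    rw [krylov_mulVec_coeff _ _ (degree_modByMonic_charpoly_lt A p), aeval_modByMonic_charpoly]
    have := congrArg (AEval'.of φ).symm hp
    rw [LinearEquiv.symm_apply_apply, AEval.of_symm_smul, ← toLin'_aeval] at this
    exact this
  · rw [← (AEval'.of φ).finrank_eq, finrank_fin_fun] at h
    refine h.trans_le ?_
    let Θ : (AEval' φ →ₗ[K[X]] AEval' φ) →ₗ[K] Matrix (Fin n) (Fin n) K :=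
      LinearMap.toMatrix'.toLinearMap ∘ₗ (AEval'.of φ).symm.conj.toLinearMap ∘ₗ
        LinearMap.restrictScalarsₗ K K[X] (AEval' φ) (AEval' φ) K
    have hΘ : Function.Injective Θ :=
      LinearMap.toMatrix'.injective.comp ((AEval'.of φ).symm.conj.injective.comp
        (LinearMap.restrictScalars_injective K))
    have hmem (T) : Θ T ∈ Subalgebra.toSubmodule (Subalgebra.centralizer K {A}) := by
      rw [Subalgebra.mem_toSubmodule, Subalgebra.mem_centralizer_iff]
      rintro _ rfl
      apply Matrix.toLin'.injective
      rw [Matrix.toLin'_mul, Matrix.toLin'_mul]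
      have h1 : Matrix.toLin' (Θ T) = (AEval'.of φ).symm.conj (T.restrictScalars K) :=
        Matrix.toLin'_toMatrix' _
      rw [h1]
      refine LinearMap.ext fun w => ?_
      change φ ((AEval'.of φ).symm (T (AEval'.of φ w))) =
        (AEval'.of φ).symm (T (AEval'.of φ (φ w)))
      rw [← AEval'.X_smul_of, map_smul, AEval'.of_symm_X_smul]
    exact LinearMap.finrank_le_finrank_of_injective
      (f := Θ.codRestrict (Subalgebra.toSubmodule (Subalgebra.centralizer K {A})) hmem)
      (fun x y h => hΘ (congrArg Subtype.val h))

/-- Linear independence of finitely many vectors is preserved by field extension, because it is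
witnessed by a one-sided inverse matrix. -/
lemma linearIndependent_comp_ringHom {L ι m : Type*} [Field L] [Finite ι] [Fintype m] (φ : K →+* L)
    {v : ι → m → K} (hv : LinearIndependent K v) : LinearIndependent L fun i => φ ∘ v i := by
  classical
  cases nonempty_fintype ι
  let V : Matrix ι m K := Matrix.of v
  have hinj : Function.Injective V.vecMulLinear := Matrix.vecMul_injective_iff.2 hv
  obtain ⟨l, hl⟩ := V.vecMulLinear.exists_leftInverse_of_injective (LinearMap.ker_eq_bot.2 hinj)
  let U : Matrix m ι K := Matrix.of fun p k => l (fun j => if p = j then 1 else 0) k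
  have hVU : V * U = 1 := by
    ext i k
    have h1 : l (v i) = Pi.single i 1 := by
      have := LinearMap.congr_fun hl (Pi.single i 1)
      simp only [V, LinearMap.comp_apply, Matrix.vecMulLinear_apply, Matrix.single_one_vecMul,
        LinearMap.id_apply] at this
      exact this
    have h2 : (V * U) i k = l (v i) k := by
      rw [LinearMap.pi_apply_eq_sum_univ l (v i), Finset.sum_apply, Matrix.mul_apply]
      rfl
    rw [h2, h1, Matrix.one_apply, Pi.single_apply]
    exact if_congr eq_comm rfl rfl
  have hmap : V.map φ * U.map φ = 1 := by
    rw [← Matrix.map_mul, hVU, Matrix.map_one _ (map_zero φ) (map_one φ)]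
  have : LinearIndependent L (V.map φ).row := by
    rw [← Matrix.vecMul_injective_iff]
    intro x y hxy
    have := congrArg (fun z => Matrix.vecMul z (U.map φ)) hxy
    simpa [Matrix.vecMul_vecMul, hmap] using this
  exact this

lemma finrank_commutant_le_map {L : Type*} [Field L] (φ : K →+* L)
    (A : Matrix (Fin n) (Fin n) K) :
    finrank K (Subalgebra.centralizer K {A}) ≤ finrank L (Subalgebra.centralizer L {A.map φ}) := by
  let b := Module.finBasis K (Subalgebra.toSubmodule (Subalgebra.centralizer K {A}))
  have hb : LinearIndependent K fun i (p : Fin n × Fin n) =>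
      (b i : Matrix (Fin n) (Fin n) K) p.1 p.2 :=
    (b.linearIndependent.map' (Submodule.subtype _) (Submodule.ker_subtype _)).map'
      (LinearEquiv.curry K K (Fin n) (Fin n)).symm.toLinearMap (LinearEquiv.ker _)
  have hL := (linearIndependent_comp_ringHom φ hb).map' (LinearEquiv.curry L L (Fin n) (Fin n)).toLinearMap
    (LinearEquiv.ker _)
  have hmem (i) : (b i : Matrix (Fin n) (Fin n) K).map φ ∈
      Subalgebra.toSubmodule (Subalgebra.centralizer L {A.map φ}) := by
    have h := (b i).2
    rw [Subalgebra.mem_toSubmodule, Subalgebra.mem_centralizer_iff] at h ⊢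
    rintro _ rfl
    rw [← Matrix.map_mul, h A rfl, Matrix.map_mul]
  have hli : LinearIndependent L fun i => (⟨(b i : Matrix (Fin n) (Fin n) K).map φ, hmem i⟩ :
      Subalgebra.toSubmodule (Subalgebra.centralizer L {A.map φ})) :=
    LinearIndependent.of_comp (Submodule.subtype _) hL
  simpa using hli.fintype_card_le_finrank

lemma isRegularElement_iff_isCyclicMatrix [Infinite K] (g : Matrix.GeneralLinearGroup (Fin n) K) :
    IsRegularElement g ↔ IsCyclicMatrix (g : Matrix (Fin n) (Fin n) K) := by
  unfold IsRegularElement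
  simp only [centralizerDim_eq_finrank, Nat.cast_le]
  constructor
  · intro h
    by_contra hg
    obtain ⟨g₀, h₀⟩ := exists_isCyclicMatrix_unit K n
    have h1 := h g₀
    rw [finrank_commutant_of_isCyclicMatrix h₀] at h1
    exact h1.not_gt (lt_finrank_commutant_of_not_isCyclicMatrix hg)
  · intro hg h
    rw [finrank_commutant_of_isCyclicMatrix hg]
    by_cases hh : IsCyclicMatrix (h : Matrix (Fin n) (Fin n) K)
    · rw [finrank_commutant_of_isCyclicMatrix hh]
    · exact (lt_finrank_commutant_of_not_isCyclicMatrix hh).le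

lemma isRegularGL_iff_isCyclicMatrix (α : Matrix.GeneralLinearGroup (Fin n) K) :
    IsRegularGL α ↔ IsCyclicMatrix (α : Matrix (Fin n) (Fin n) K) := by
  have hmap : ((Matrix.GeneralLinearGroup.map (algebraMap K (AlgebraicClosure K)) α :
      Matrix.GeneralLinearGroup (Fin n) _) : Matrix (Fin n) (Fin n) (AlgebraicClosure K)) =
      (α : Matrix (Fin n) (Fin n) K).map (algebraMap K (AlgebraicClosure K)) := rfl
  rw [IsRegularGL, isRegularElement_iff_isCyclicMatrix, hmap]
  refine ⟨fun h => ?_, isCyclicMatrix_map _⟩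
  by_contra hA
  have h1 := finrank_commutant_le_map (algebraMap K (AlgebraicClosure K))
    (α : Matrix (Fin n) (Fin n) K)
  rw [finrank_commutant_of_isCyclicMatrix h] at h1
  exact h1.not_gt (lt_finrank_commutant_of_not_isCyclicMatrix hA)

end

/-! ### Conjugacy classes of cyclic matrices -/

section

open Module Polynomial

variable {F : Type*} [Field F] {n : ℕ}

/-- The invertible elements of the commutant of `g` form its centralizer in `GL`. -/
def unitsCommutantEquiv {K : Type*} [Field K] {n : ℕ} (g : Matrix.GeneralLinearGroup (Fin n) K) :
    (Subalgebra.centralizer K {(g : Matrix (Fin n) (Fin n) K)})ˣ ≃ Subgroup.centralizer {g} where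
  toFun u := ⟨⟨u.1.1, u.2.1, congrArg Subtype.val u.3, congrArg Subtype.val u.4⟩, by
    rw [Subgroup.mem_centralizer_iff]
    rintro _ rfl
    exact Units.ext ((Subalgebra.mem_centralizer_iff K).1 u.1.2 _ rfl)⟩
  invFun x :=
    have h := Subgroup.mem_centralizer_iff.1 x.2 g rfl
    have h' := Subgroup.mem_centralizer_iff.1 (inv_mem x.2) g rfl
    ⟨⟨x.1.1, by
      rw [Subalgebra.mem_centralizer_iff]; rintro _ rfl; exact congrArg Units.val h⟩,
    ⟨(x.1⁻¹).1, by
      rw [Subalgebra.mem_centralizer_iff]; rintro _ rfl; exact congrArg Units.val h'⟩,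
    Subtype.ext x.1.mul_inv, Subtype.ext x.1.inv_mul⟩
  left_inv _ := rfl
  right_inv _ := rfl

/-- Orbit-stabilizer: the cyclic matrices with characteristic polynomial `f` form one conjugacy
class, and the centralizer of each is the unit group of `F[X] / (f)`. -/
lemma card_cyclic_charpoly_eq_mul_card_units {f : F[X]} (hf : f.Monic) (hn : f.natDegree = n)
    (h0 : f.coeff 0 ≠ 0) :
    Nat.card {α : Matrix.GeneralLinearGroup (Fin n) F //
        IsCyclicMatrix (α : Matrix (Fin n) (Fin n) F) ∧
          (α : Matrix (Fin n) (Fin n) F).charpoly = f} *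
      Nat.card (F[X] ⧸ Ideal.span {f})ˣ = Nat.card (Matrix.GeneralLinearGroup (Fin n) F) := by
  obtain ⟨A, hA, rfl⟩ := exists_isCyclicMatrix_charpoly hf hn
  have hdet : A.det ≠ 0 := by
    rw [Matrix.det_eq_sign_charpoly_coeff]
    exact mul_ne_zero (pow_ne_zero _ (neg_ne_zero.2 one_ne_zero)) h0
  let g := Matrix.GeneralLinearGroup.mkOfDetNeZero A hdet
  have hg : (g : Matrix (Fin n) (Fin n) F) = A := rfl
  have horb : {α : Matrix.GeneralLinearGroup (Fin n) F |
        IsCyclicMatrix (α : Matrix (Fin n) (Fin n) F) ∧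
          (α : Matrix (Fin n) (Fin n) F).charpoly = A.charpoly} =
      MulAction.orbit (ConjAct (Matrix.GeneralLinearGroup (Fin n) F)) g := by
    ext α
    rw [ConjAct.mem_orbit_conjAct, isConj_comm, isConj_iff]
    constructor
    · rintro ⟨h1, h2⟩
      obtain ⟨P, hP⟩ := exists_conj_of_charpoly_eq hA h1 h2.symm
      exact ⟨P, mul_inv_eq_of_eq_mul (Units.ext hP)⟩
    · rintro ⟨P, rfl⟩
      refine ⟨hA.conj P ?_, ?_⟩
      · rw [← hg, ← Units.val_mul, ← Units.val_mul, inv_mul_cancel_right]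
      · rw [Units.val_mul, Units.val_mul, hg, Matrix.coe_units_inv, Matrix.charpoly_units_conj]
  have hunits : Nat.card (F[X] ⧸ Ideal.span {A.charpoly})ˣ =
      Nat.card (MulAction.stabilizer (ConjAct (Matrix.GeneralLinearGroup (Fin n) F)) g) := by
    rw [← Subgroup.nat_card_centralizer_nat_card_stabilizer,
      Nat.card_congr (Units.mapEquiv (commutantEquivOfIsCyclicMatrix hA).toMulEquiv).toEquiv]
    exact Nat.card_congr (unitsCommutantEquiv g)
  change _ = Nat.card (ConjAct (Matrix.GeneralLinearGroup (Fin n) F))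
  rw [hunits, ← Nat.card_congr (MulAction.orbitProdStabilizerEquivGroup
    (ConjAct (Matrix.GeneralLinearGroup (Fin n) F)) g), Nat.card_prod, ← horb]
  rfl

/-- Monic polynomials of degree `n` with non-zero constant term. -/
abbrev MonicUnitConst (F : Type*) [Field F] (n : ℕ) : Type _ :=
  {f : F[X] // f.Monic ∧ f.natDegree = n ∧ f.coeff 0 ≠ 0}

/-- A monic polynomial corresponds to its coefficients below the leading one. In degree `0` the
constant term is the leading one, which is why the degree is positive here. -/
noncomputable def monicUnitConstEquiv (F : Type*) [Field F] (n : ℕ) :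
    MonicUnitConst F (n + 1) ≃ {c : Fin (n + 1) → F // c 0 ≠ 0} where
  toFun f := ⟨fun i => f.1.coeff i, f.2.2.2⟩
  invFun c := ⟨X ^ (n + 1) + ((degreeLTEquiv F (n + 1)).symm c.1 : F[X]), by
    have hd := mem_degreeLT.1 ((degreeLTEquiv F (n + 1)).symm c.1).2
    have hd' : ((degreeLTEquiv F (n + 1)).symm c.1 : F[X]).degree <
        (X ^ (n + 1) : F[X]).degree := by
      rwa [degree_X_pow]
    refine ⟨monic_X_pow_add hd, ?_, ?_⟩
    · rw [natDegree_add_eq_left_of_degree_lt hd', natDegree_X_pow]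
    · have := congrFun ((degreeLTEquiv F (n + 1)).apply_symm_apply c.1) 0
      change ((degreeLTEquiv F (n + 1)).symm c.1 : F[X]).coeff 0 = c.1 0 at this
      rw [coeff_add, this, coeff_X_pow]
      simpa using c.2⟩
  left_inv f := by
    have hlt : (f.1 - X ^ (n + 1)).degree < ((n + 1 : ℕ) : WithBot ℕ) := by
      have hdeg : f.1.degree = ((n + 1 : ℕ) : WithBot ℕ) := by
        rw [degree_eq_natDegree f.2.1.ne_zero, f.2.2.1]
      rw [← hdeg]
      exact degree_sub_lt_left (by rw [hdeg, degree_X_pow]) f.2.1.ne_zero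
        (by rw [f.2.1.leadingCoeff, leadingCoeff_X_pow])
    have : (degreeLTEquiv F (n + 1)).symm (fun i => f.1.coeff i) =
        ⟨f.1 - X ^ (n + 1), mem_degreeLT.2 hlt⟩ := by
      rw [LinearEquiv.symm_apply_eq]
      ext i
      change _ = (f.1 - X ^ (n + 1)).coeff i
      rw [coeff_sub, coeff_X_pow, if_neg i.2.ne, sub_zero]
    refine Subtype.ext ?_
    change X ^ (n + 1) + ((degreeLTEquiv F (n + 1)).symm (fun i => f.1.coeff i) : F[X]) = f.1
    rw [this, add_sub_cancel]
  right_inv c := by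
    refine Subtype.ext (funext fun i => ?_)
    have := congrFun ((degreeLTEquiv F (n + 1)).apply_symm_apply c.1) i
    change ((degreeLTEquiv F (n + 1)).symm c.1 : F[X]).coeff i = c.1 i at this
    change (X ^ (n + 1) + ((degreeLTEquiv F (n + 1)).symm c.1 : F[X])).coeff i = c.1 i
    rw [coeff_add, this, coeff_X_pow, if_neg i.2.ne, zero_add]

lemma card_monicUnitConst_zero (F : Type*) [Field F] : Nat.card (MonicUnitConst F 0) = 1 := by
  rw [Nat.card_eq_one_iff_unique]
  refine ⟨⟨fun f g => Subtype.ext ?_⟩, ⟨⟨1, monic_one, natDegree_one, by simp⟩⟩⟩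
  rw [f.2.1.natDegree_eq_zero.1 f.2.2.1,
    g.2.1.natDegree_eq_zero.1 g.2.2.1]

instance finite_monicUnitConst [Finite F] (n : ℕ) : Finite (MonicUnitConst F n) := by
  cases n with
  | zero => exact (Nat.card_pos_iff.1 (by rw [card_monicUnitConst_zero]; exact one_pos)).2
  | succ n => exact Finite.of_equiv _ (monicUnitConstEquiv F n).symm

lemma card_monicUnitConst_succ [Finite F] (n : ℕ) :
    Nat.card (MonicUnitConst F (n + 1)) = (Nat.card F - 1) * Nat.card F ^ n := by
  classical
  have := Fintype.ofFinite F
  have e : {c : Fin (n + 1) → F // c 0 ≠ 0} ≃ {a : F // a ≠ 0} × (Fin n → F) :=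
    ((Fin.consEquiv fun _ => F).symm.subtypeEquiv (q := fun x => x.1 ≠ 0) fun c => by rfl).trans
      (Equiv.prodSubtypeFstEquivSubtypeProd (p := fun a : F => a ≠ 0))
  have h := Nat.card_congr ((monicUnitConstEquiv F n).trans e)
  rw [h, Nat.card_prod, Nat.card_fun,
    ← Nat.card_congr (unitsEquivNeZero (G₀ := F)), Nat.card_units]
  simp

/-- Sorting the cyclic elements by their characteristic polynomials. -/
lemma probRegularGL_eq_sum (F : Type*) [Field F] [Fintype F] (n : ℕ)
    [Fintype (MonicUnitConst F n)] :
    probRegularGL F n =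
      ∑ f : MonicUnitConst F n, ((Nat.card (F[X] ⧸ Ideal.span {f.1})ˣ : ℝ))⁻¹ := by
  have hpos : (Nat.card (Matrix.GeneralLinearGroup (Fin n) F) : ℝ) ≠ 0 := by
    exact_mod_cast Nat.card_pos.ne'
  let e : {α : Matrix.GeneralLinearGroup (Fin n) F // IsRegularGL α} ≃
      Σ f : MonicUnitConst F n, {α : Matrix.GeneralLinearGroup (Fin n) F //
        IsCyclicMatrix (α : Matrix (Fin n) (Fin n) F) ∧
          (α : Matrix (Fin n) (Fin n) F).charpoly = f.1} :=
    { toFun := fun α => ⟨⟨(α.1 : Matrix (Fin n) (Fin n) F).charpoly, Matrix.charpoly_monic _,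
          by simp [Matrix.charpoly_natDegree_eq_dim], fun h => by
            have h1 := Matrix.det_eq_sign_charpoly_coeff (α.1 : Matrix (Fin n) (Fin n) F)
            rw [h, mul_zero] at h1
            exact α.1.det_ne_zero h1⟩,
        ⟨α.1, (isRegularGL_iff_isCyclicMatrix _).1 α.2, rfl⟩⟩
      invFun := fun x => ⟨x.2.1, (isRegularGL_iff_isCyclicMatrix _).2 x.2.2.1⟩
      left_inv := fun α => rfl
      right_inv := by
        rintro ⟨⟨f, hf⟩, ⟨α, hα, h⟩⟩
        change _ = f at h
        subst h
        rfl }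
  rw [probRegularGL, Nat.card_congr e, Nat.card_sigma, Nat.cast_sum, Finset.sum_div]
  refine Finset.sum_congr rfl fun f _ => ?_
  rw [← card_cyclic_charpoly_eq_mul_card_units f.2.1 f.2.2.1 f.2.2.2, Nat.cast_mul]
  rw [← card_cyclic_charpoly_eq_mul_card_units f.2.1 f.2.2.1 f.2.2.2, Nat.cast_mul] at hpos
  rw [div_mul_cancel_left₀ (left_ne_zero_of_mul hpos)]

end

/-! ### Unique factorization and units modulo a polynomial -/

section

open Module Polynomial

variable {F : Type*} [Field F]

/-- Monic irreducible polynomials other than `X`. -/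
abbrev MonicPrime (F : Type*) [Field F] : Type _ := {p : F[X] // p.Monic ∧ Irreducible p ∧ p ≠ X}

/-- The degree of a prime. -/
noncomputable def MonicPrime.deg (p : MonicPrime F) : ℕ := p.1.natDegree

lemma MonicPrime.deg_pos (p : MonicPrime F) : 0 < p.deg := p.2.2.1.natDegree_pos

/-- The monic polynomial with a given prime factorization. -/
noncomputable def factorizationPoly (v : MonicPrime F →₀ ℕ) : F[X] := v.prod fun p k => p.1 ^ k

lemma factorizationPoly_add (u v : MonicPrime F →₀ ℕ) :
    factorizationPoly (u + v) = factorizationPoly u * factorizationPoly v :=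
  Finsupp.prod_add_index' (by simp) (by simp [pow_add])

lemma factorizationPoly_single (p : MonicPrime F) (k : ℕ) :
    factorizationPoly (Finsupp.single p k) = p.1 ^ k :=
  Finsupp.prod_single_index (by simp)

lemma factorizationPoly_zero : factorizationPoly (0 : MonicPrime F →₀ ℕ) = 1 :=
  Finsupp.prod_zero_index

lemma factorizationPoly_monic (v : MonicPrime F →₀ ℕ) : (factorizationPoly v).Monic :=
  monic_prod_of_monic _ _ fun p _ => p.2.1.pow _

lemma natDegree_factorizationPoly (v : MonicPrime F →₀ ℕ) :
    (factorizationPoly v).natDegree = Finsupp.weight MonicPrime.deg v := by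
  rw [factorizationPoly, Finsupp.prod, natDegree_prod_of_monic _ _ fun p _ => p.2.1.pow _,
    Finsupp.weight_apply, Finsupp.sum]
  exact Finset.sum_congr rfl fun p _ => natDegree_pow _ _

lemma coeff_zero_factorizationPoly_ne_zero (v : MonicPrime F →₀ ℕ) :
    (factorizationPoly v).coeff 0 ≠ 0 := by
  rw [coeff_zero_eq_eval_zero, factorizationPoly, Finsupp.prod, eval_prod, Finset.prod_ne_zero_iff]
  intro p _
  rw [eval_pow]
  refine pow_ne_zero _ fun h => p.2.2.2 ?_
  rw [← coeff_zero_eq_eval_zero, ← X_dvd_iff] at h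
  exact (eq_of_monic_of_associated monic_X p.2.1
    (irreducible_X.associated_of_dvd p.2.2.1 h)).symm

lemma MonicPrime.dvd_factorizationPoly_iff (p : MonicPrime F) (v : MonicPrime F →₀ ℕ) :
    p.1 ∣ factorizationPoly v ↔ v p ≠ 0 := by
  constructor
  · intro h
    obtain ⟨q, hq, hpq⟩ := (p.2.2.1.prime.dvd_finsetProd_iff _).1 h
    have h1 := p.2.2.1.prime.dvd_of_dvd_pow hpq
    have : p = q := Subtype.ext (eq_of_monic_of_associated p.2.1 q.2.1
      (p.2.2.1.associated_of_dvd q.2.2.1 h1))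
    exact this ▸ Finsupp.mem_support_iff.1 hq
  · intro h
    exact (dvd_pow_self _ h).trans (Finset.dvd_prod_of_mem (fun q : MonicPrime F => q.1 ^ v q)
      (Finsupp.mem_support_iff.2 h))

lemma Finsupp.exists_eq_single_add {ι : Type*} {v : ι →₀ ℕ} {p : ι} (h : v p ≠ 0) :
    ∃ v', v = Finsupp.single p 1 + v' :=
  ⟨v - Finsupp.single p 1, (add_tsub_cancel_of_le (Finsupp.single_le_iff.2
    (Nat.one_le_iff_ne_zero.2 h))).symm⟩

lemma factorizationPoly_injective : Function.Injective (factorizationPoly (F := F)) := by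
  intro u
  induction h : Finsupp.weight MonicPrime.deg u using Nat.strong_induction_on generalizing u with
  | _ n ih =>
  intro v huv
  by_cases hu : u = 0
  · subst hu
    ext p
    by_contra hp
    have := (p.dvd_factorizationPoly_iff v).2 (Ne.symm hp)
    rw [← huv, p.dvd_factorizationPoly_iff] at this
    exact this rfl
  · obtain ⟨p, hp⟩ := Finsupp.ne_iff.1 hu
    have hv := (p.dvd_factorizationPoly_iff u).2 hp
    rw [huv, p.dvd_factorizationPoly_iff] at hv
    obtain ⟨u, rfl⟩ := Finsupp.exists_eq_single_add hp
    obtain ⟨v, rfl⟩ := Finsupp.exists_eq_single_add hv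
    rw [factorizationPoly_add, factorizationPoly_add] at huv
    rw [ih _ ?_ rfl (mul_left_cancel₀ (factorizationPoly_monic _).ne_zero huv)]
    have := p.deg_pos
    rw [← h, map_add, Finsupp.weight_single]
    simp
    omega

lemma exists_factorizationPoly_eq {f : F[X]} (hf : f.Monic) (h0 : f.coeff 0 ≠ 0) :
    ∃ v : MonicPrime F →₀ ℕ, factorizationPoly v = f := by
  induction h : f.natDegree using Nat.strong_induction_on generalizing f with
  | _ n ih =>
  by_cases hu : IsUnit f
  · exact ⟨0, by rw [factorizationPoly_zero, hf.eq_one_of_isUnit hu]⟩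
  · obtain ⟨p, hp, hi, g, rfl⟩ := exists_monic_irreducible_factor f hu
    rw [mul_coeff_zero] at h0
    have hg := hp.of_mul_monic_left hf
    obtain ⟨v, rfl⟩ := ih g.natDegree (by
      rw [← h, hp.natDegree_mul hg]; have := hi.natDegree_pos; omega) hg
        (right_ne_zero_of_mul h0) rfl
    have hX : p ≠ X := by
      rintro rfl
      simp at h0
    refine ⟨Finsupp.single ⟨p, hp, hi, hX⟩ 1 + v, ?_⟩
    · rw [factorizationPoly_add, factorizationPoly_single, pow_one]

/-- Unique factorization of monic polynomials with non-zero constant term. -/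
noncomputable def factorizationEquiv (F : Type*) [Field F] (n : ℕ) :
    {v : MonicPrime F →₀ ℕ // Finsupp.weight MonicPrime.deg v = n} ≃ MonicUnitConst F n :=
  Equiv.ofBijective (fun v => ⟨factorizationPoly v.1, factorizationPoly_monic _,
      by rw [natDegree_factorizationPoly, v.2], coeff_zero_factorizationPoly_ne_zero _⟩) <| by
    constructor
    · intro u v h
      exact Subtype.ext (factorizationPoly_injective (congrArg Subtype.val h))
    · rintro ⟨f, hf, hn, h0⟩
      obtain ⟨v, rfl⟩ := exists_factorizationPoly_eq hf h0
      exact ⟨⟨v, by rw [← natDegree_factorizationPoly, hn]⟩, rfl⟩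

lemma card_units_quotient_mul {f g : F[X]} (h : IsCoprime f g) :
    Nat.card (F[X] ⧸ Ideal.span {f * g})ˣ =
      Nat.card (F[X] ⧸ Ideal.span {f})ˣ * Nat.card (F[X] ⧸ Ideal.span {g})ˣ := by
  rw [← Nat.card_prod]
  refine Nat.card_congr (((Units.mapEquiv ?_).trans MulEquiv.prodUnits).toEquiv)
  exact ((Ideal.quotEquivOfEq (Ideal.span_singleton_mul_span_singleton f g).symm).trans
    (Ideal.quotientMulEquivQuotientProd _ _
      ((Ideal.isCoprime_span_singleton_iff _ _).2 h))).toMulEquiv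

lemma card_units_quotient_one : Nat.card (F[X] ⧸ Ideal.span {(1 : F[X])})ˣ = 1 := by
  have : Subsingleton (F[X] ⧸ Ideal.span {(1 : F[X])}) :=
    Ideal.Quotient.subsingleton_iff.2 Ideal.span_singleton_one
  exact Nat.card_unique

lemma card_units_quotient_prod {ι : Type*} (s : Finset ι) (f : ι → F[X])
    (h : Pairwise (Function.onFun IsCoprime f)) :
    Nat.card (F[X] ⧸ Ideal.span {∏ i ∈ s, f i})ˣ =
      ∏ i ∈ s, Nat.card (F[X] ⧸ Ideal.span {f i})ˣ := by
  classical
  induction s using Finset.induction_on with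
  | empty => rw [Finset.prod_empty, Finset.prod_empty, card_units_quotient_one]
  | insert a s ha ih =>
    rw [Finset.prod_insert ha, Finset.prod_insert ha, ← ih, card_units_quotient_mul]
    exact IsCoprime.prod_right fun i hi => h (by rintro rfl; exact ha hi)

lemma natCard_quotient_span [Finite F] {f : F[X]} (hf : f ≠ 0) :
    Nat.card (F[X] ⧸ Ideal.span {f}) = Nat.card F ^ f.natDegree := by
  have : Module.Finite F (F[X] ⧸ Ideal.span {f}) := (AdjoinRoot.powerBasis hf).finite
  rw [Module.natCard_eq_pow_finrank (K := F), finrank_quotient_span_eq_natDegree]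

lemma isUnit_quotient_mk_iff {f g : F[X]} :
    IsUnit (Ideal.Quotient.mk (Ideal.span {g}) f) ↔ IsCoprime f g := by
  constructor
  · intro h
    obtain ⟨b, hb⟩ := h.exists_right_inv
    obtain ⟨a, rfl⟩ := Ideal.Quotient.mk_surjective b
    rw [← map_mul, ← map_one (Ideal.Quotient.mk _), Ideal.Quotient.eq,
      Ideal.mem_span_singleton] at hb
    obtain ⟨c, hc⟩ := hb
    exact ⟨a, -c, by linear_combination hc⟩
  · rintro ⟨a, b, hab⟩
    refine IsUnit.of_mul_eq_one (Ideal.Quotient.mk _ a) ?_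
    rw [← map_mul, ← map_one (Ideal.Quotient.mk _), Ideal.Quotient.eq, Ideal.mem_span_singleton]
    exact ⟨-b, by linear_combination hab⟩

/-- The non-units modulo a power of a prime `p` are the multiples of `p`. -/
lemma card_units_quotient_pow [Finite F] {p : F[X]} (hp : Irreducible p) {k : ℕ} (hk : k ≠ 0) :
    Nat.card (F[X] ⧸ Ideal.span {p ^ k})ˣ * Nat.card F ^ p.natDegree =
      Nat.card F ^ (p ^ k).natDegree * (Nat.card F ^ p.natDegree - 1) := by
  classical
  have hfin : Finite (F[X] ⧸ Ideal.span {p ^ k}) := Nat.finite_of_card_ne_zero (by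
    rw [natCard_quotient_span (pow_ne_zero _ hp.ne_zero)]
    exact pow_ne_zero _ Nat.card_pos.ne')
  let π : (F[X] ⧸ Ideal.span {p ^ k}) →+* F[X] ⧸ Ideal.span {p} :=
    Ideal.Quotient.factor (Ideal.span_singleton_le_span_singleton.2 (dvd_pow_self p hk))
  have hπ : Function.Surjective π := Ideal.Quotient.factor_surjective _
  have h1 : Nat.card (F[X] ⧸ Ideal.span {p ^ k}) =
      Nat.card (RingHom.ker π) * Nat.card (F[X] ⧸ Ideal.span {p}) := by
    rw [Submodule.card_eq_card_quotient_mul_card (RingHom.ker π),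
      ← Nat.card_congr (RingHom.quotientKerEquivOfSurjective hπ).toEquiv, mul_comm]
  have h2 : Nat.card (F[X] ⧸ Ideal.span {p ^ k}) =
      Nat.card (F[X] ⧸ Ideal.span {p ^ k})ˣ + Nat.card (RingHom.ker π) := by
    rw [← Nat.card_congr (Equiv.sumCompl fun a : F[X] ⧸ Ideal.span {p ^ k} => IsUnit a),
      Nat.card_sum]
    congr 1
    · exact Nat.card_congr (Submonoid.unitsTypeEquivIsUnitSubmonoid
        (M := F[X] ⧸ Ideal.span {p ^ k})).symm.toEquiv
    · refine Nat.card_congr (Equiv.subtypeEquivRight fun a => ?_)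
      obtain ⟨f, rfl⟩ := Ideal.Quotient.mk_surjective a
      rw [isUnit_quotient_mk_iff, IsCoprime.pow_right_iff (Nat.pos_of_ne_zero hk), RingHom.mem_ker,
        Ideal.Quotient.factor_mk, Ideal.Quotient.eq_zero_iff_mem, Ideal.mem_span_singleton,
        isCoprime_comm, hp.coprime_iff_not_dvd, not_not]
  rw [natCard_quotient_span (pow_ne_zero _ hp.ne_zero)] at h1 h2
  rw [natCard_quotient_span hp.ne_zero] at h1
  rw [Nat.mul_sub, mul_one]
  refine Nat.eq_sub_of_add_eq ?_
  conv_lhs => rw [h1]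
  conv_rhs => rw [h2]
  ring

/-- The number of units modulo a polynomial, in terms of its factorization. -/
lemma inv_card_units_quotient_factorizationPoly [Finite F] (v : MonicPrime F →₀ ℕ) :
    (Nat.card (F[X] ⧸ Ideal.span {factorizationPoly v})ˣ : ℝ)⁻¹ =
      (Nat.card F : ℝ)⁻¹ ^ Finsupp.weight MonicPrime.deg v *
        ∏ p ∈ v.support, (1 - (Nat.card F : ℝ)⁻¹ ^ p.deg)⁻¹ := by
  have hq : 1 < Nat.card F := Finite.one_lt_card
  have hco : Pairwise (Function.onFun IsCoprime fun p : MonicPrime F => p.1 ^ v p) := by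
    intro p q hpq
    refine IsCoprime.pow (p.2.2.1.coprime_iff_not_dvd.2 fun h => hpq ?_)
    exact Subtype.ext (eq_of_monic_of_associated p.2.1 q.2.1
      (p.2.2.1.associated_of_dvd q.2.2.1 h))
  rw [factorizationPoly, Finsupp.prod, card_units_quotient_prod _ _ hco, Nat.cast_prod,
    ← Finset.prod_inv_distrib, Finsupp.weight_apply, Finsupp.sum, ← Finset.prod_pow_eq_pow_sum,
    ← Finset.prod_mul_distrib]
  refine Finset.prod_congr rfl fun p hp => ?_
  have h := card_units_quotient_pow p.2.2.1 (Finsupp.mem_support_iff.1 hp)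
  have h' := congrArg (Nat.cast : ℕ → ℝ) h
  rw [natDegree_pow] at h'
  have hqd : 1 < Nat.card F ^ p.1.natDegree := Nat.one_lt_pow p.deg_pos.ne' hq
  rw [Nat.cast_mul, Nat.cast_mul, Nat.cast_sub hqd.le, Nat.cast_pow, Nat.cast_pow,
    Nat.cast_one] at h'
  have hqd' : (1 : ℝ) < (Nat.card F : ℝ) ^ p.1.natDegree := by exact_mod_cast hqd
  have hq0 : (0 : ℝ) < Nat.card F := by exact_mod_cast (zero_lt_one.trans hq)
  rw [smul_eq_mul, MonicPrime.deg, inv_pow, inv_pow, ← mul_inv, inv_inj]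
  field_simp
  linear_combination h'

end

/-! ### Euler products and zeta sums -/

section

open Filter Topology

variable {ι : Type*} {d : ι → ℕ} {x : ℝ}

/-- The exponent vector of the radical: every non-zero exponent is replaced by `1`. -/
noncomputable def Finsupp.radical (v : ι →₀ ℕ) : ι →₀ ℕ :=
  v.mapRange (fun k => if k = 0 then 0 else 1) (by simp)

lemma Finsupp.radical_apply (v : ι →₀ ℕ) (i : ι) : v.radical i = if v i = 0 then 0 else 1 :=
  Finsupp.mapRange_apply ..

lemma Finsupp.radical_le_iff (h w : ι →₀ ℕ) : h.radical ≤ w ↔ h.support ⊆ w.support := by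
  rw [Finsupp.le_def]
  refine forall_congr' fun i => ?_
  rw [radical_apply, Finsupp.mem_support_iff, Finsupp.mem_support_iff]
  split_ifs with hi <;> simp [hi, Nat.one_le_iff_ne_zero]

/-- Finite Euler product: the numbers with all their primes in `S`, weighted by `x ^ weight`. -/
lemma hasSum_support_subset (hx0 : 0 ≤ x) (hx1 : x < 1) (hd : ∀ i, 0 < d i) (S : Finset ι) :
    HasSum (fun h : {h : ι →₀ ℕ // h.support ⊆ S} => x ^ Finsupp.weight d h.1)
      (∏ i ∈ S, (1 - x ^ d i)⁻¹) := by
  classical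
  induction S using Finset.induction_on with
  | empty =>
    have : Unique {h : ι →₀ ℕ // h.support ⊆ ∅} :=
      ⟨⟨⟨0, by simp⟩⟩, fun h => Subtype.ext (by simpa using h.2)⟩
    have h0 : (default : {h : ι →₀ ℕ // h.support ⊆ ∅}).1 = 0 := by
      simpa using (default : {h : ι →₀ ℕ // h.support ⊆ ∅}).2
    convert hasSum_unique _ using 1
    rw [h0, map_zero, pow_zero, Finset.prod_empty]
  | insert a S ha ih =>
    let e : ℕ × {h : ι →₀ ℕ // h.support ⊆ S} ≃ {h : ι →₀ ℕ // h.support ⊆ insert a S} :=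
      { toFun := fun z => ⟨Finsupp.single a z.1 + z.2.1, by
          refine Finsupp.support_add.trans (Finset.union_subset ?_ ?_)
          · exact Finsupp.support_single_subset.trans (by simp)
          · exact z.2.2.trans (Finset.subset_insert _ _)⟩
        invFun := fun h => (h.1 a, ⟨h.1.erase a, by
          rw [Finsupp.support_erase]
          exact Finset.subset_insert_iff.1 h.2⟩)
        left_inv := by
          rintro ⟨k, h, hh⟩
          have hha : h a = 0 := by
            by_contra h0
            exact ha (hh (Finsupp.mem_support_iff.2 h0))
          refine Prod.ext ?_ (Subtype.ext ?_)
          · simp [hha]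
          · change (Finsupp.single a k + h).erase a = h
            rw [Finsupp.erase_add, Finsupp.erase_single, zero_add, Finsupp.erase_of_notMem_support]
            rwa [Finsupp.notMem_support_iff]
        right_inv := fun h => Subtype.ext (Finsupp.single_add_erase a h.1) }
    rw [← e.hasSum_iff, Finset.prod_insert ha]
    have hg := hasSum_geometric_of_lt_one (pow_nonneg hx0 (d a)) (pow_lt_one₀ hx0 hx1 (hd a).ne')
    have hsum : Summable fun z : ℕ × {h : ι →₀ ℕ // h.support ⊆ S} =>
        (x ^ d a) ^ z.1 * x ^ Finsupp.weight d z.2.1 :=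
      Summable.mul_of_nonneg (f := fun k : ℕ => (x ^ d a) ^ k)
        (g := fun h : {h : ι →₀ ℕ // h.support ⊆ S} => x ^ Finsupp.weight d h.1)
        hg.summable ih.summable (Pi.le_def.2 fun k => pow_nonneg (pow_nonneg hx0 _) k)
        (Pi.le_def.2 fun h => pow_nonneg hx0 _)
    have hfun : (fun h : {h : ι →₀ ℕ // h.support ⊆ insert a S} => x ^ Finsupp.weight d h.1) ∘ e =
        fun z => (x ^ d a) ^ z.1 * x ^ Finsupp.weight d z.2.1 := by
      funext z
      change x ^ Finsupp.weight d (Finsupp.single a z.1 + z.2.1) = _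
      rw [map_add, Finsupp.weight_single, pow_add, smul_eq_mul, mul_comm z.1, pow_mul]
    rw [hfun]
    exact HasSum.mul (f := fun k : ℕ => (x ^ d a) ^ k)
      (g := fun h : {h : ι →₀ ℕ // h.support ⊆ S} => x ^ Finsupp.weight d h.1) hg ih hsum

/-- The zeta sum of `ι →₀ ℕ`, graded by weight, when there are as many elements of weight `m` as
monic polynomials of degree `m` with non-zero constant term. -/
lemma hasSum_pow_weight {q : ℕ} (hq : 1 < q)
    (hfin : ∀ m, Finite {v : ι →₀ ℕ // Finsupp.weight d v = m})
    (h0 : Nat.card {v : ι →₀ ℕ // Finsupp.weight d v = 0} = 1)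
    (hs : ∀ m, Nat.card {v : ι →₀ ℕ // Finsupp.weight d v = m + 1} = (q - 1) * q ^ m)
    {s : ℕ} (hs2 : 2 ≤ s) :
    HasSum (fun v : ι →₀ ℕ => (q : ℝ)⁻¹ ^ (s * Finsupp.weight d v))
      ((1 - (q : ℝ)⁻¹ ^ s) / (1 - (q : ℝ)⁻¹ ^ (s - 1))) := by
  have hq0 : (0 : ℝ) < q := by exact_mod_cast (zero_lt_one.trans hq)
  have hx1 : (q : ℝ)⁻¹ < 1 := inv_lt_one_of_one_lt₀ (by exact_mod_cast hq)
  obtain ⟨t, rfl⟩ : ∃ t, s = t + 1 := ⟨s - 1, by omega⟩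
  rw [Nat.add_sub_cancel]
  have hy1 : (q : ℝ)⁻¹ ^ t < 1 := pow_lt_one₀ (by positivity) hx1 (by omega)
  have hfib (m : ℕ) : HasSum (fun v : {v : ι →₀ ℕ // Finsupp.weight d v = m} =>
      (q : ℝ)⁻¹ ^ ((t + 1) * Finsupp.weight d v.1))
      (Nat.card {v : ι →₀ ℕ // Finsupp.weight d v = m} * (q : ℝ)⁻¹ ^ ((t + 1) * m)) := by
    have := Fintype.ofFinite {v : ι →₀ ℕ // Finsupp.weight d v = m}
    convert hasSum_fintype _ using 1
    rw [Finset.sum_congr rfl fun v _ => by rw [v.2], Finset.sum_const, Finset.card_univ,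
      nsmul_eq_mul, Nat.card_eq_fintype_card]
  have hsum : HasSum (fun m => (Nat.card {v : ι →₀ ℕ // Finsupp.weight d v = m} : ℝ) *
      (q : ℝ)⁻¹ ^ ((t + 1) * m)) ((1 - (q : ℝ)⁻¹ ^ (t + 1)) / (1 - (q : ℝ)⁻¹ ^ t)) := by
    have hterm (m : ℕ) : (Nat.card {v : ι →₀ ℕ // Finsupp.weight d v = m + 1} : ℝ) *
        (q : ℝ)⁻¹ ^ ((t + 1) * (m + 1)) =
        (1 - (q : ℝ)⁻¹) * (q : ℝ)⁻¹ ^ t * ((q : ℝ)⁻¹ ^ t) ^ m := by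
      rw [hs, Nat.cast_mul, Nat.cast_sub hq.le, Nat.cast_pow, Nat.cast_one]
      have : (q : ℝ)⁻¹ ^ ((t + 1) * (m + 1)) =
          (q : ℝ)⁻¹ ^ m * (q : ℝ)⁻¹ * ((q : ℝ)⁻¹ ^ t * ((q : ℝ)⁻¹ ^ t) ^ m) := by ring
      rw [this]
      have h1 : (q : ℝ) ^ m * (q : ℝ)⁻¹ ^ m = 1 := by
        rw [← mul_pow, mul_inv_cancel₀ hq0.ne', one_pow]
      have h2 : (q : ℝ) * (q : ℝ)⁻¹ = 1 := mul_inv_cancel₀ hq0.ne'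
      linear_combination ((q : ℝ) - 1) * (q : ℝ)⁻¹ * ((q : ℝ)⁻¹ ^ t * ((q : ℝ)⁻¹ ^ t) ^ m) * h1
        + ((q : ℝ)⁻¹ ^ t * ((q : ℝ)⁻¹ ^ t) ^ m) * h2
    have hg := (hasSum_geometric_of_lt_one (by positivity) hy1).mul_left
      ((1 - (q : ℝ)⁻¹) * (q : ℝ)⁻¹ ^ t)
    have hval : (1 - (q : ℝ)⁻¹ ^ (t + 1)) / (1 - (q : ℝ)⁻¹ ^ t) -
        ∑ i ∈ Finset.range 1, (Nat.card {v : ι →₀ ℕ // Finsupp.weight d v = i} : ℝ) *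
          (q : ℝ)⁻¹ ^ ((t + 1) * i) = (1 - (q : ℝ)⁻¹) * (q : ℝ)⁻¹ ^ t * (1 - (q : ℝ)⁻¹ ^ t)⁻¹ := by
      have : 1 - (q : ℝ)⁻¹ ^ t ≠ 0 := (sub_pos.2 hy1).ne'
      rw [Finset.sum_range_one, h0, pow_succ]
      generalize (q : ℝ)⁻¹ = y at *
      field_simp
      ring
    rw [← hasSum_nat_add_iff' 1, hval]
    simpa only [hterm] using hg
  rw [← (Equiv.sigmaFiberEquiv (Finsupp.weight d : (ι →₀ ℕ) → ℕ)).hasSum_iff]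
  refine HasSum.sigma_of_hasSum hsum hfib ?_
  refine (summable_sigma_of_nonneg fun _ => pow_nonneg (inv_nonneg.2 hq0.le) _).2 ?_
  exact ⟨fun m => (hfib m).summable, by
    simpa only [Function.comp_def, Equiv.sigmaFiberEquiv, Equiv.coe_fn_mk, (hfib _).tsum_eq] using
      hsum.summable⟩

/-- Every exponent other than `1` is uniquely `2 a + 3 b` with `b ≤ 1`, and every exponent is uniquely
`2 c + b` with `b ≤ 1`. Taken at every prime at once, this turns a squarefull number times a sixth
power into a square times a cube, as `2 a + 3 b + 6 c = 2 a + 3 (2 c + b)`. -/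
lemma exists_equiv_weight_radical (d : ι → ℕ) :
    ∃ e : (ι →₀ ℕ) × (ι →₀ ℕ) ≃ (ι →₀ ℕ) × (ι →₀ ℕ), ∀ z,
      Finsupp.weight d (z.1 + z.1.radical) + 6 * Finsupp.weight d z.2 =
        2 * Finsupp.weight d (e z).1 + 3 * Finsupp.weight d (e z).2 := by
  -- An exponent `k` of `z.1` gives the exponent `k + 1`, or `0` if `k = 0`, of `z.1 + z.1.radical`;
  -- `a` and `b` are the pair attached to it, and `k` below inverts them.
  let a : ℕ → ℕ := fun k => if k % 2 = 1 then (k + 1) / 2 else k / 2 - 1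
  let b : ℕ → ℕ → ℕ := fun k c => 2 * c + if k ≠ 0 ∧ k % 2 = 0 then 1 else 0
  let k : ℕ → ℕ → ℕ := fun a b => if b % 2 = 0 then 2 * a - 1 else 2 * a + 2
  let e : (ι →₀ ℕ) × (ι →₀ ℕ) ≃ (ι →₀ ℕ) × (ι →₀ ℕ) :=
    { toFun := fun z => (z.1.mapRange a (by simp [a]), Finsupp.zipWith b (by simp [b]) z.1 z.2)
      invFun := fun z => (Finsupp.zipWith k (by simp [k]) z.1 z.2, z.2.mapRange (· / 2) (by simp))
      left_inv := fun z => by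
        refine Prod.ext (Finsupp.ext fun i => ?_) (Finsupp.ext fun i => ?_)
        · simp only [Finsupp.zipWith_apply, Finsupp.mapRange_apply, a, b, k]
          split_ifs <;> omega
        · simp only [Finsupp.zipWith_apply, Finsupp.mapRange_apply, b]
          split_ifs <;> omega
      right_inv := fun z => by
        refine Prod.ext (Finsupp.ext fun i => ?_) (Finsupp.ext fun i => ?_)
        · simp only [Finsupp.zipWith_apply, Finsupp.mapRange_apply, a, k]
          split_ifs <;> omega
        · simp only [Finsupp.zipWith_apply, Finsupp.mapRange_apply, b, k]
          split_ifs <;> omega }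
  refine ⟨e, fun z => ?_⟩
  have : z.1 + z.1.radical + 6 • z.2 = 2 • (e z).1 + 3 • (e z).2 := by
    ext i
    simp only [Finsupp.add_apply, Finsupp.smul_apply, Finsupp.radical_apply, e, Equiv.coe_fn_mk,
      Finsupp.zipWith_apply, Finsupp.mapRange_apply, a, b, smul_eq_mul]
    split_ifs <;> omega
  simpa using congrArg (Finsupp.weight d) this

end

/-! ### The limit -/

section

open Filter Topology

variable {ι : Type*} {d : ι → ℕ}

/-- The multiples of the radical of `h` are translates of arbitrary elements. -/
lemma card_weight_radical_le (d : ι → ℕ) (h : ι →₀ ℕ) (n : ℕ) :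
    Nat.card {w : {w : ι →₀ ℕ // Finsupp.weight d w = n} // h.radical ≤ w.1} =
      if Finsupp.weight d h.radical ≤ n then
        Nat.card {w : ι →₀ ℕ // Finsupp.weight d w = n - Finsupp.weight d h.radical} else 0 := by
  split_ifs with hn
  · exact Nat.card_congr
      { toFun := fun w => ⟨w.1.1 - h.radical, by
          have := congrArg (Finsupp.weight d) (tsub_add_cancel_of_le w.2)
          rw [map_add, w.1.2] at this
          omega⟩
        invFun := fun w => ⟨⟨w.1 + h.radical, by rw [map_add, w.2]; omega⟩, le_add_self⟩
        left_inv := fun w => Subtype.ext (Subtype.ext (tsub_add_cancel_of_le w.2))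
        right_inv := fun w => Subtype.ext (add_tsub_cancel_right _ _) }
  · refine Nat.card_eq_zero.2 (Or.inl ⟨fun w => hn ?_⟩)
    have := congrArg (Finsupp.weight d) (tsub_add_cancel_of_le w.2)
    rw [map_add, w.1.2] at this
    omega

/-- Exchanging the sum over `w` with the Euler products over the primes of `w`. -/
lemma hasSum_sum_euler_product {x : ℝ} (hx0 : 0 ≤ x) (hx1 : x < 1) (hd : ∀ i, 0 < d i) (n : ℕ)
    [Fintype {w : ι →₀ ℕ // Finsupp.weight d w = n}] :
    HasSum (fun h : ι →₀ ℕ => x ^ Finsupp.weight d h *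
        (x ^ n * Nat.card {w : {w : ι →₀ ℕ // Finsupp.weight d w = n} // h.radical ≤ w.1}))
      (∑ w : {w : ι →₀ ℕ // Finsupp.weight d w = n},
        x ^ Finsupp.weight d w.1 * ∏ i ∈ w.1.support, (1 - x ^ d i)⁻¹) := by
  classical
  have hw (w : {w : ι →₀ ℕ // Finsupp.weight d w = n}) :
      HasSum (fun h : ι →₀ ℕ => x ^ n * if h.radical ≤ w.1 then x ^ Finsupp.weight d h else 0)
        (x ^ Finsupp.weight d w.1 * ∏ i ∈ w.1.support, (1 - x ^ d i)⁻¹) := by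
    rw [w.2]
    refine HasSum.mul_left _ ?_
    have h1 := hasSum_support_subset hx0 hx1 hd w.1.support
    have h2 := (hasSum_subtype_iff_indicator (s := {h : ι →₀ ℕ | h.support ⊆ w.1.support})
      (f := fun h => x ^ Finsupp.weight d h)).1 h1
    have hind : ({h : ι →₀ ℕ | h.support ⊆ w.1.support}.indicator fun h => x ^ Finsupp.weight d h) =
        fun h => if h.radical ≤ w.1 then x ^ Finsupp.weight d h else 0 := by
      funext h
      simp only [Finsupp.radical_le_iff, Set.indicator_apply, Set.mem_ofPred_eq]
    rw [hind] at h2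
    exact h2
  convert hasSum_sum (s := Finset.univ) fun w _ => hw w using 1
  funext h
  rw [← Finset.mul_sum, ← Finset.sum_filter, Finset.sum_const, nsmul_eq_mul,
    Nat.card_eq_fintype_card, Fintype.card_subtype]
  ring

/-- The sum over `h` is the sum over the squarefull numbers `h * rad h`, which the bijection with
squares times cubes evaluates. -/
lemma hasSum_pow_weight_add_radical {q : ℕ} (hq : 1 < q)
    (hfin : ∀ m, Finite {v : ι →₀ ℕ // Finsupp.weight d v = m})
    (h0 : Nat.card {v : ι →₀ ℕ // Finsupp.weight d v = 0} = 1)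
    (hs : ∀ m, Nat.card {v : ι →₀ ℕ // Finsupp.weight d v = m + 1} = (q - 1) * q ^ m) :
    HasSum (fun h : ι →₀ ℕ => (q : ℝ)⁻¹ ^ Finsupp.weight d (h + h.radical))
      ((1 - (q : ℝ)⁻¹ ^ 5) / ((1 - (q : ℝ)⁻¹) * (1 + (q : ℝ)⁻¹ ^ 3))) := by
  have hx0 : (0 : ℝ) < (q : ℝ)⁻¹ := inv_pos.2 (by exact_mod_cast (zero_lt_one.trans hq))
  have hx1 : (q : ℝ)⁻¹ < 1 := inv_lt_one_of_one_lt₀ (by exact_mod_cast hq)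
  have z2 := hasSum_pow_weight hq hfin h0 hs (le_refl 2)
  have z3 := hasSum_pow_weight hq hfin h0 hs (s := 3) (by norm_num)
  have z6 := hasSum_pow_weight hq hfin h0 hs (s := 6) (by norm_num)
  generalize (q : ℝ)⁻¹ = x at *
  obtain ⟨e, he⟩ := exists_equiv_weight_radical d
  have hnn (f : (ι →₀ ℕ) → ℕ) : 0 ≤ fun v => x ^ f v := Pi.le_def.2 fun v => pow_nonneg hx0.le _
  have z23 : HasSum (fun z : (ι →₀ ℕ) × (ι →₀ ℕ) =>
      x ^ (2 * Finsupp.weight d z.1) * x ^ (3 * Finsupp.weight d z.2)) _ :=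
    HasSum.mul (f := fun v => x ^ (2 * Finsupp.weight d v))
      (g := fun v => x ^ (3 * Finsupp.weight d v)) z2 z3
      (Summable.mul_of_nonneg (f := fun v => x ^ (2 * Finsupp.weight d v))
        (g := fun v => x ^ (3 * Finsupp.weight d v)) z2.summable z3.summable (hnn _) (hnn _))
  rw [← e.hasSum_iff] at z23
  have hcomp : (fun z : (ι →₀ ℕ) × (ι →₀ ℕ) =>
      x ^ (2 * Finsupp.weight d z.1) * x ^ (3 * Finsupp.weight d z.2)) ∘ e = fun z =>
      x ^ Finsupp.weight d (z.1 + z.1.radical) * x ^ (6 * Finsupp.weight d z.2) := by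
    funext z
    rw [Function.comp_apply, ← pow_add, ← he, pow_add]
  rw [hcomp] at z23
  have hsum : Summable fun h : ι →₀ ℕ => x ^ Finsupp.weight d (h + h.radical) := by
    have := z23.summable.comp_injective (i := fun h : ι →₀ ℕ => (h, 0))
      (fun a b hab => congrArg Prod.fst hab)
    simpa [Function.comp_def] using this
  have hprod := HasSum.mul (f := fun h : ι →₀ ℕ => x ^ Finsupp.weight d (h + h.radical))
      (g := fun v => x ^ (6 * Finsupp.weight d v)) hsum.hasSum z6 z23.summable
  have heq := hprod.unique z23
  convert hsum.hasSum using 1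
  generalize (∑' h : ι →₀ ℕ, x ^ Finsupp.weight d (h + h.radical)) = S at heq ⊢
  have hp (k : ℕ) (hk : k ≠ 0) : 1 - x ^ k ≠ 0 := (sub_pos.2 (pow_lt_one₀ hx0.le hx1 hk)).ne'
  have h1 := hp 1 one_ne_zero
  have h2 := hp 2 two_ne_zero
  have h5 := hp 5 (by norm_num)
  have h6 := hp 6 (by norm_num)
  rw [pow_one] at h1
  have h3 : 1 + x ^ 3 ≠ 0 := by positivity
  have h3' := hp 3 (by norm_num)
  norm_num at heq
  field_simp at heq ⊢
  have h6' : 1 - x ^ 6 = (1 - x ^ 3) * (1 + x ^ 3) := by ring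
  rw [h6'] at heq
  apply mul_left_cancel₀ h3'
  linear_combination -heq

/-- The limit is taken term by term in the sum over `h`, dominated by the sum over the
`h + h.radical`. -/
lemma tendsto_sum_euler_product {q : ℕ} (hq : 1 < q) (hd : ∀ i, 0 < d i)
    [hfin : ∀ m, Fintype {v : ι →₀ ℕ // Finsupp.weight d v = m}]
    (h0 : Nat.card {v : ι →₀ ℕ // Finsupp.weight d v = 0} = 1)
    (hs : ∀ m, Nat.card {v : ι →₀ ℕ // Finsupp.weight d v = m + 1} = (q - 1) * q ^ m) :
    Tendsto (fun n => ∑ w : {w : ι →₀ ℕ // Finsupp.weight d w = n},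
        (q : ℝ)⁻¹ ^ Finsupp.weight d w.1 * ∏ i ∈ w.1.support, (1 - (q : ℝ)⁻¹ ^ d i)⁻¹) atTop
      (𝓝 ((1 - (q : ℝ)⁻¹ ^ 5) / (1 + (q : ℝ)⁻¹ ^ 3))) := by
  have hq0 : (0 : ℝ) < q := by exact_mod_cast (zero_lt_one.trans hq)
  have hx0 : (0 : ℝ) < (q : ℝ)⁻¹ := inv_pos.2 hq0
  have hx1 : (q : ℝ)⁻¹ < 1 := inv_lt_one_of_one_lt₀ (by exact_mod_cast hq)
  have hqx (k : ℕ) : (q : ℝ)⁻¹ ^ k * (q : ℝ) ^ k = 1 := by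
    rw [← mul_pow, inv_mul_cancel₀ hq0.ne', one_pow]
  have hS := hasSum_pow_weight_add_radical hq (fun m => Finite.of_fintype _) h0 hs
  have hle (m : ℕ) : (Nat.card {v : ι →₀ ℕ // Finsupp.weight d v = m} : ℝ) ≤ (q : ℝ) ^ m := by
    cases m with
    | zero => rw [h0]; simp
    | succ m =>
      rw [hs, Nat.cast_mul, Nat.cast_sub hq.le, Nat.cast_one, Nat.cast_pow, pow_succ, mul_comm]
      gcongr
      linarith
  simp_rw [← (hasSum_sum_euler_product hx0.le hx1 hd _).tsum_eq]
  have hlim : (1 - (q : ℝ)⁻¹ ^ 5) / (1 + (q : ℝ)⁻¹ ^ 3) =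
      ∑' h : ι →₀ ℕ, (q : ℝ)⁻¹ ^ Finsupp.weight d (h + h.radical) * (1 - (q : ℝ)⁻¹) := by
    rw [tsum_mul_right, hS.tsum_eq]
    have : 1 - (q : ℝ)⁻¹ ≠ 0 := (sub_pos.2 hx1).ne'
    have h3 : 1 + (q : ℝ)⁻¹ ^ 3 ≠ 0 := by positivity
    generalize (q : ℝ)⁻¹ = x at *
    field_simp
  rw [hlim]
  refine tendsto_tsum_of_dominated_convergence hS.summable (fun h => ?_)
    (Eventually.of_forall fun n h => ?_)
  · -- For `n` above the weight of the radical, the term does not depend on `n`.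
    refine tendsto_const_nhds.congr' ?_
    filter_upwards [eventually_gt_atTop (Finsupp.weight d h.radical)] with n hn
    rw [card_weight_radical_le, if_pos hn.le]
    obtain ⟨m, rfl⟩ := Nat.exists_eq_add_of_lt hn
    rw [show Finsupp.weight d h.radical + m + 1 - Finsupp.weight d h.radical = m + 1 by omega, hs,
      map_add, Nat.cast_mul, Nat.cast_sub hq.le, Nat.cast_pow, Nat.cast_one, pow_add, pow_add,
      pow_add, pow_one]
    have h1 := hqx m
    have h2 := hqx 1
    rw [pow_one, pow_one] at h2
    generalize (q : ℝ)⁻¹ ^ m = y at *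
    linear_combination (-(q : ℝ)⁻¹ ^ Finsupp.weight d h *
      (q : ℝ)⁻¹ ^ Finsupp.weight d h.radical) * ((1 - (q : ℝ)⁻¹) * h1 + y * q ^ m * h2)
  · rw [Real.norm_of_nonneg (by positivity), card_weight_radical_le, map_add, pow_add]
    refine mul_le_mul_of_nonneg_left ?_ (by positivity)
    split_ifs with hn
    · obtain ⟨m, rfl⟩ := Nat.exists_eq_add_of_le hn
      rw [Nat.add_sub_cancel_left, pow_add, mul_assoc]
      refine mul_le_of_le_one_right (by positivity) ?_
      rw [← hqx m]
      exact mul_le_mul_of_nonneg_left (hle m) (by positivity)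
    · simp only [Nat.cast_zero, mul_zero]
      positivity

end

theorem theorem2 (F : Type*) [Field F] [Fintype F] :
    Filter.Tendsto (fun n : ℕ => probRegularGL F n) Filter.atTop
      (nhds ((1 - 1 / (Fintype.card F : ℝ) ^ 5) / (1 + 1 / (Fintype.card F : ℝ) ^ 3))) := by
  classical
  have hfin (n : ℕ) : Finite {v : MonicPrime F →₀ ℕ // Finsupp.weight MonicPrime.deg v = n} :=
    Finite.of_equiv _ (factorizationEquiv F n).symm
  have (n : ℕ) := Fintype.ofFinite {v : MonicPrime F →₀ ℕ // Finsupp.weight MonicPrime.deg v = n}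
  have (n : ℕ) := Fintype.ofFinite (MonicUnitConst F n)
  have key := tendsto_sum_euler_product (ι := MonicPrime F) (d := MonicPrime.deg)
    (q := Nat.card F) Finite.one_lt_card MonicPrime.deg_pos
    (by rw [Nat.card_congr (factorizationEquiv F 0), card_monicUnitConst_zero])
    (fun m => by rw [Nat.card_congr (factorizationEquiv F (m + 1)), card_monicUnitConst_succ])
  rw [Nat.card_eq_fintype_card] at key
  simp only [one_div, ← inv_pow]
  refine key.congr fun n => ?_
  rw [probRegularGL_eq_sum, ← (factorizationEquiv F n).sum_comp]
  refine Finset.sum_congr rfl fun w _ => ?_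
  have := inv_card_units_quotient_factorizationPoly w.1
  rw [Nat.card_eq_fintype_card (α := F)] at this
  exact this.symm
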